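/- Let $N\ge 1$ and $k\ge 0$ be integers. Let $P_k$ be the finite set of level-$k$ integrable highest weights of $\widehat{\mathfrak{su}}(N)_k$, i.e. of Dynkin labels $a=(a_1,\dots,a_{N-1})\in\mathbb{Z}_{\ge 0}^{N-1}$ with $a_1+\cdots+a_{N-1}\le k$, identified with $\sum_i a_i\omega_i$ ($\omega_i$ the fundamental weights), and let $1=(0,\dots,0)\in P_k$ be the vacuum. Let $S$ be the modular $S$-matrix, given by the Kac--Peterson formula \[ S_{ab}=\frac{i^{N(N-1)/2}}{\sqrt{N\,(k+N)^{N-1}}}\sum_{w\in W}\det(w)\,\exp\Bigl(-\frac{2\pi i}{k+N}\,\bigl(a+\rho,\,w(b+\rho)\bigr)\Bigr)\qquad(a,b\in P_k), \] where $W\cong\mathfrak{S}_N$ is the Weyl group of $\mathfrak{su}(N)$, $\rho=\sum_i\omega_i$ is the Weyl vector, and $(\cdot,\cdot)$ is the invariant form for which roots have squared length $2$. Let the fusion coefficients be given by the Verlinde formula \[ N_{ab}^c=\sum_{x\in P_k}\frac{S_{ax}\,S_{bx}\,\overline{S_{cx}}}{S_{1x}}\qquad(a,b,c\in P_k), \]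 and let $\mathcal{F}$ be the fusion ring of the $SU(N)_k$ Wess--Zumino--Witten model, generated by the primary fields $[a]$, $a\in P_k$, with the bilinear fusion product determined by $[a]\otimes[b]=\sum_{c\in P_k}N_{ab}^c\,[c]$. Then the vacuum representation $[1]$ acts as the identity of $\mathcal{F}$: one has $N_{1b}^c=\delta_{bc}$ for all $b,c\in P_k$; consequently $[1]\otimes[a]=[a]=[a]\otimes[1]$ for all $a\in P_k$, and $[1]\otimes x=x=x\otimes[1]$ for all $x\in\mathcal{F}$. -/

import Mathlib

open scoped BigOperators

noncomputable section

namespace WZW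

/-- The primary fields of the `SU(N)_k` WZW model: level-`k` integrable highest weights, given by
their Dynkin labels `(a₁, …, a_{N-1})`, nonnegative integers with `a₁ + ⋯ + a_{N-1} ≤ k`. -/
def Weight (N k : ℕ) : Type := {a : Fin (N - 1) → ℕ // ∑ i, a i ≤ k}

namespace Weight

variable {N k : ℕ}

instance : DecidableEq (Weight N k) :=
  inferInstanceAs (DecidableEq {a : Fin (N - 1) → ℕ // ∑ i, a i ≤ k})

theorem label_le (a : Weight N k) (i : Fin (N - 1)) : a.1 i ≤ k :=
  (Finset.single_le_sum (fun j _ => Nat.zero_le (a.1 j)) (Finset.mem_univ i)).trans a.2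

instance : Fintype (Weight N k) :=
  Fintype.ofInjective
    (fun a : Weight N k => fun i => (⟨a.1 i, Nat.lt_succ_of_le (a.label_le i)⟩ : Fin (k + 1)))
    (fun _ _ h => Subtype.ext (funext fun i => congrArg Fin.val (congrFun h i)))

/-- The vacuum: all Dynkin labels vanish (the trivial representation). -/
def vacuum (N k : ℕ) : Weight N k := ⟨fun _ => 0, by simp⟩

end Weight

/-- The fundamental weights of `su(N)`, `ω_m = e_1 + ⋯ + e_m - (m / N) (e_1 + ⋯ + e_N)` for
`m = 1, …, N - 1` (here `m = i + 1`), in the hyperplane of `ℝ^N` orthogonal to `(1, …, 1)`,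
where the roots are `e_i - e_j` and the invariant form is the dot product. -/
def fundamentalWeight (N : ℕ) (i : Fin (N - 1)) : Fin N → ℝ :=
  fun j => (if (j : ℕ) ≤ (i : ℕ) then 1 else 0) - ((i : ℕ) + 1 : ℝ) / (N : ℝ)

/-- The Weyl vector, the sum of the fundamental weights. -/
def weylVector (N : ℕ) : Fin N → ℝ := ∑ i, fundamentalWeight N i

/-- The vector `∑ a_i ω_i` with Dynkin labels `a`. -/
def Weight.toVector {N k : ℕ} (a : Weight N k) : Fin N → ℝ :=
  ∑ i, (a.1 i : ℝ) • fundamentalWeight N i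

/-- The Weyl group of `su(N)`, the symmetric group, acts by permuting coordinates; the
determinant of this action is the sign of the permutation. -/
def weylAct {N : ℕ} (w : Equiv.Perm (Fin N)) (v : Fin N → ℝ) : Fin N → ℝ :=
  fun j => v (w.symm j)

/-- The modular `S`-matrix by the Kac–Peterson formula
`S_{ab} = i^{|Δ₊|} / √(N (k+N)^{N-1}) ∑_w det(w) exp(-2πi (a + ρ, w(b + ρ)) / (k+N))`,
where `|Δ₊| = N (N - 1) / 2`. -/
def modularS {N k : ℕ} (a b : Weight N k) : ℂ :=
  Complex.I ^ (N * (N - 1) / 2) / ((Real.sqrt ((N : ℝ) * ((k : ℝ) + N) ^ (N - 1)) : ℝ) : ℂ) *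
    ∑ w : Equiv.Perm (Fin N), ((Equiv.Perm.sign w : ℤ) : ℂ) *
      Complex.exp (-(2 * (Real.pi : ℂ) * Complex.I / ((k : ℂ) + N)) *
        (((a.toVector + weylVector N) ⬝ᵥ weylAct w (b.toVector + weylVector N) : ℝ) : ℂ))

/-- The fusion coefficient `N_{ab}^c`, by the Verlinde formula
`N_{ab}^c = ∑_x S_{ax} S_{bx} S_{cx}^* / S_{1x}`, where `1` is the vacuum. -/
def fusionCoeff {N k : ℕ} (a b c : Weight N k) : ℂ :=
  ∑ x : Weight N k,
    modularS a x * modularS b x * (starRingEnd ℂ) (modularS c x) / modularS (Weight.vacuum N k) x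

/-- The complexified fusion ring: the complex vector space on the primary fields, with the
bilinear product for which `[a] ⊗ [b] = ∑_c N_{ab}^c [c]`. -/
def FusionAlgebra (N k : ℕ) : Type := Weight N k → ℂ

namespace FusionAlgebra

variable {N k : ℕ}

instance : AddCommGroup (FusionAlgebra N k) := inferInstanceAs (AddCommGroup (Weight N k → ℂ))

instance : Module ℂ (FusionAlgebra N k) := inferInstanceAs (Module ℂ (Weight N k → ℂ))

/-- The basis vector `[a]`. -/
def primary (a : Weight N k) : FusionAlgebra N k := fun c => if c = a then 1 else 0

/-- The fusion product. -/
def fuse (x y : FusionAlgebra N k) : FusionAlgebra N k :=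
  fun c => ∑ a : Weight N k, ∑ b : Weight N k, x a * y b * fusionCoeff a b c

instance : Mul (FusionAlgebra N k) := ⟨fuse⟩

theorem mul_apply (x y : FusionAlgebra N k) (c : Weight N k) :
    (x * y) c = ∑ a : Weight N k, ∑ b : Weight N k, x a * y b * fusionCoeff a b c := rfl

theorem add_apply (x y : FusionAlgebra N k) (c : Weight N k) : (x + y) c = x c + y c := rfl

theorem zero_apply (c : Weight N k) : (0 : FusionAlgebra N k) c = 0 := rfl

instance : NonUnitalNonAssocRing (FusionAlgebra N k) :=
  { (inferInstance : AddCommGroup (FusionAlgebra N k)),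
    (inferInstance : Mul (FusionAlgebra N k)) with
    left_distrib := fun x y z => by
      funext c
      simp only [mul_apply, add_apply, mul_add, add_mul, Finset.sum_add_distrib]
    right_distrib := fun x y z => by
      funext c
      simp only [mul_apply, add_apply, add_mul, Finset.sum_add_distrib]
    zero_mul := fun x => by
      funext c
      simp only [mul_apply, zero_apply, zero_mul, Finset.sum_const_zero]
    mul_zero := fun x => by
      funext c
      simp only [mul_apply, zero_apply, mul_zero, zero_mul, Finset.sum_const_zero] }

theorem primary_mul_primary_apply (a b c : Weight N k) :
    (primary a * primary b) c = fusionCoeff a b c := by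
  simp [mul_apply, primary]

end FusionAlgebra

/-- The fusion ring of the `SU(N)_k` WZW model: the ring generated by the primary fields `[a]`
under addition, subtraction and the fusion product. As the fusion coefficients are integers,
this is the free abelian group on the primary fields with the fusion product. -/
def fusionRing (N k : ℕ) : NonUnitalSubring (FusionAlgebra N k) :=
  NonUnitalSubring.closure (Set.range FusionAlgebra.primary)

/-- The class `[a]` of a primary field in the fusion ring. -/
def cls {N k : ℕ} (a : Weight N k) : fusionRing N k :=
  ⟨FusionAlgebra.primary a, NonUnitalSubring.subset_closure ⟨a, rfl⟩⟩

end WZW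

end

/-! ### Weights as strictly decreasing integer sequences -/

namespace WZW

open Finset Equiv

/-! With the vacuum in the first slot, `S_{1x}` cancels in the Verlinde formula, so the claim
reduces to `S_{1x} ≠ 0` (`modularS_vacuum_ne_zero`, a Vandermonde determinant) and unitarity of `S`
(`sum_modularS_mul_conj_modularS`).

For unitarity, write `n = k + N`. Up to a constant, `S_{bx}` is the determinant of exponentials in
`b + ρ` and the integer sequence `x.shifted`. Weights correspond to `N`-element subsets of `{0, …, n
- 1}` containing `0`, so summing over `x` is, up to `N!`, summing over tuples through `0`.
Andréief's identity expresses this through the Gram entries `∑_t q^t`, where `q` is the exponential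
of `(b + ρ)_i - (c + ρ)_j` and `q^n = ω` is independent of `i` and `j` (`sum_tuples_eq`).

If `ω = 1`, a Gram entry vanishes unless the two coordinates agree modulo `n`, and the alcove being
a fundamental domain leaves only `b = c`. If `ω ≠ 1`, prescribing the point `0` is a rank one
perturbation that merely rescales the Gram matrix with unchanged determinant, so the sum is zero. -/

/-- The strictly decreasing sequence `l_i = ∑_{m ≥ i} (a_m + 1)` of a weight, with last entry `0`. -/
def Weight.shifted {M k : ℕ} (a : Weight (M + 1) k) (i : Fin (M + 1)) : ℕ :=
  ∑ m : Fin M, if (i : ℕ) ≤ (m : ℕ) then a.1 m + 1 else 0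

/-- The mean of the entries of `Weight.shifted`. -/
noncomputable def Weight.shift {M k : ℕ} (a : Weight (M + 1) k) : ℝ :=
  ∑ m : Fin M, ((a.1 m : ℝ) + 1) * ((((m : ℕ) : ℝ) + 1) / ((M + 1 : ℕ) : ℝ))

/-- The vector `a + ρ`. -/
noncomputable def Weight.regular {N k : ℕ} (a : Weight N k) : Fin N → ℝ := a.toVector + weylVector N

variable {M k : ℕ}

/-- The indicator parts of the fundamental weights add up to the integer sequence; their trace
corrections are the same in every coordinate. -/
theorem Weight.regular_apply (a : Weight (M + 1) k) (i : Fin (M + 1)) :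
    a.regular i = (a.shifted i : ℝ) - a.shift := by
  have h : a.regular i = ∑ m : Fin M, ((a.1 m : ℝ) + 1) *
      ((if (i : ℕ) ≤ (m : ℕ) then 1 else 0) - (((m : ℕ) : ℝ) + 1) / ((M + 1 : ℕ) : ℝ)) := by
    simp only [Weight.regular, Weight.toVector, weylVector, Pi.add_apply, Finset.sum_apply,
      Pi.smul_apply, smul_eq_mul]
    rw [← Finset.sum_add_distrib]
    exact Finset.sum_congr rfl fun m _ => by simp only [fundamentalWeight]; ring
  rw [h, Weight.shifted, Weight.shift, Nat.cast_sum, ← Finset.sum_sub_distrib]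
  refine Finset.sum_congr rfl fun m _ => ?_
  split_ifs <;> push_cast <;> ring

theorem card_filter_le (m : Fin M) :
    (Finset.univ.filter fun i : Fin (M + 1) => (i : ℕ) ≤ (m : ℕ)).card = (m : ℕ) + 1 := by
  have : (Finset.univ.filter fun i : Fin (M + 1) => (i : ℕ) ≤ (m : ℕ)) =
      Finset.Iic m.castSucc := by
    ext i; simp [Fin.le_def]
  rw [this, Fin.card_Iic]; simp

theorem Weight.sum_regular (a : Weight (M + 1) k) : ∑ i, a.regular i = 0 := by
  simp only [Weight.regular_apply, Finset.sum_sub_distrib, Finset.sum_const, Finset.card_univ,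
    Fintype.card_fin, nsmul_eq_mul, Weight.shift, Weight.shifted]
  push_cast
  rw [Finset.sum_comm, Finset.mul_sum, sub_eq_zero]
  refine Finset.sum_congr rfl fun m _ => ?_
  rw [← Finset.sum_filter, Finset.sum_const, card_filter_le, nsmul_eq_mul]
  push_cast
  field_simp

theorem Weight.shifted_castSucc (a : Weight (M + 1) k) (i : Fin M) :
    a.shifted i.castSucc = a.shifted i.succ + a.1 i + 1 := by
  have h : ∀ m : Fin M, (if ((i.castSucc : Fin (M + 1)) : ℕ) ≤ (m : ℕ) then a.1 m + 1 else 0) =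
      (if ((i.succ : Fin (M + 1)) : ℕ) ≤ (m : ℕ) then a.1 m + 1 else 0) +
        if m = i then a.1 m + 1 else 0 := by
    intro m
    rcases lt_trichotomy (m : ℕ) (i : ℕ) with h | h | h
    · have : m ≠ i := fun e => by simp [e] at h
      rw [if_neg (by simpa using h), if_neg (by simp; omega), if_neg this]
    · have : m = i := Fin.ext h
      simp [this]
    · have : m ≠ i := fun e => by simp [e] at h
      simp [this, h, h.le]
  simp only [Weight.shifted, h, Finset.sum_add_distrib]
  simp [add_assoc]

theorem Weight.shifted_last (a : Weight (M + 1) k) : a.shifted (Fin.last M) = 0 :=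
  Finset.sum_eq_zero fun m _ => if_neg (by simp)

theorem Weight.shifted_strictAnti (a : Weight (M + 1) k) : StrictAnti a.shifted :=
  Fin.strictAnti_iff_succ_lt.2 fun i => by rw [a.shifted_castSucc]; omega

theorem Weight.shifted_lt (a : Weight (M + 1) k) (i : Fin (M + 1)) :
    a.shifted i < k + (M + 1) := by
  have h : a.shifted i ≤ ∑ m : Fin M, (a.1 m + 1) :=
    Finset.sum_le_sum fun m _ => by split_ifs <;> omega
  have h2 : ∑ m : Fin M, a.1 m ≤ k := a.2
  rw [Finset.sum_add_distrib] at h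
  simp at h
  omega

theorem Weight.shifted_injective :
    Function.Injective (Weight.shifted : Weight (M + 1) k → Fin (M + 1) → ℕ) := by
  intro a b h
  refine Subtype.ext (funext fun (i : Fin M) => ?_)
  have h1 := a.shifted_castSucc i
  have h2 := b.shifted_castSucc i
  rw [h] at h1
  omega

theorem Weight.regular_strictAnti (a : Weight (M + 1) k) : StrictAnti a.regular := by
  intro i j h
  have : (a.shifted j : ℝ) < a.shifted i := by exact_mod_cast a.shifted_strictAnti h
  rw [a.regular_apply, a.regular_apply]; linarith

theorem Weight.regular_injective :
    Function.Injective (Weight.regular : Weight (M + 1) k → Fin (M + 1) → ℝ) := by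
  intro a b h
  have hs : a.shift = b.shift := by
    have h0 := congrFun h (Fin.last M)
    simpa [Weight.regular_apply, Weight.shifted_last] using h0
  refine Weight.shifted_injective (funext fun i => ?_)
  have h0 := congrFun h i
  rw [a.regular_apply, b.regular_apply, hs] at h0
  exact_mod_cast sub_left_injective h0

theorem Weight.regular_sub_lt (a : Weight (M + 1) k) (i j : Fin (M + 1)) :
    a.regular i - a.regular j < (k : ℝ) + (M + 1) := by
  have : (a.shifted i : ℝ) < k + (M + 1) := by exact_mod_cast a.shifted_lt i
  rw [a.regular_apply, a.regular_apply]
  have : (0 : ℝ) ≤ a.shifted j := Nat.cast_nonneg _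
  linarith

/-- Every strictly decreasing sequence in `[0, k + M + 1)` ending in `0` comes from a weight. -/
theorem Weight.exists_shifted_eq (t : Fin (M + 1) → ℕ) (ht : StrictAnti t)
    (hlt : ∀ i, t i < k + (M + 1)) (h0 : t (Fin.last M) = 0) :
    ∃ a : Weight (M + 1) k, a.shifted = t := by
  have hstep : ∀ i : Fin M, t i.succ < t i.castSucc := Fin.strictAnti_iff_succ_lt.1 ht
  -- The labels are the gaps minus one; they telescope to `t 0 - M`, which is at most `k`.
  have hsum : ∑ i : Fin M, (t i.castSucc - t i.succ - 1) ≤ k := by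
    have h1 : ∑ i : Fin M, (((t i.castSucc - t i.succ - 1 : ℕ) : ℤ)) =
        ∑ i : Fin M, ((t i.castSucc : ℤ) - t i.succ - 1) :=
      Finset.sum_congr rfl fun i _ => by have := hstep i; omega
    have h2 : ∑ i : Fin M, (((t i.castSucc : ℤ) - t i.succ - 1)) = t 0 - M := by
      have e1 := Fin.sum_univ_succ (fun i => (t i : ℤ))
      have e2 := Fin.sum_univ_castSucc (fun i => (t i : ℤ))
      rw [h0] at e2
      simp only [Finset.sum_sub_distrib, Finset.sum_const, Finset.card_univ, Fintype.card_fin,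
        nsmul_eq_mul, mul_one]
      push_cast at e2
      linarith
    have := hlt 0
    zify
    rw [h1, h2]
    omega
  obtain ⟨a, ha⟩ : ∃ a : Weight (M + 1) k, ∀ i : Fin M, a.1 i = t i.castSucc - t i.succ - 1 :=
    ⟨⟨_, hsum⟩, fun _ => rfl⟩
  refine ⟨a, funext fun i => ?_⟩
  induction i using Fin.reverseInduction with
  | last => rw [Weight.shifted_last, h0]
  | cast i ih =>
    rw [Weight.shifted_castSucc, ih, ha]
    have := hstep i
    omega

/-- A sum over weights of a symmetric function of the shifted labels, as a sum over tuples. -/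
theorem factorial_mul_sum_weight (g : (Fin (M + 1) → Fin (k + (M + 1))) → ℂ)
    (hsymm : ∀ (t) (σ : Perm (Fin (M + 1))), g (t ∘ σ) = g t)
    (hinj : ∀ t, ¬ Function.Injective t → g t = 0) :
    ((M + 1).factorial : ℂ) * ∑ x : Weight (M + 1) k, g (fun i => ⟨x.shifted i, x.shifted_lt i⟩) =
      ∑ t : Fin (M + 1) → Fin (k + (M + 1)), ∑ j, if (t j : ℕ) = 0 then g t else 0 := by
  set L : Weight (M + 1) k → Fin (M + 1) → Fin (k + (M + 1)) :=
    fun x i => ⟨x.shifted i, x.shifted_lt i⟩ with hL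
  have hLanti : ∀ x, StrictAnti (L x) := fun x i j h => x.shifted_strictAnti h
  -- An injective tuple takes the value `0` at most once, so the sum over `j` only tests whether it
  -- does.
  have h1 : ∑ t : Fin (M + 1) → Fin (k + (M + 1)), (∑ j, if (t j : ℕ) = 0 then g t else 0) =
      ∑ t ∈ Finset.univ.filter (fun t : Fin (M + 1) → Fin (k + (M + 1)) =>
        Function.Injective t ∧ ∃ j, (t j : ℕ) = 0), g t := by
    rw [Finset.sum_filter]
    refine Finset.sum_congr rfl fun t _ => ?_
    split_ifs with h
    · obtain ⟨hi, j, hj⟩ := h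
      rw [Finset.sum_eq_single j]
      · rw [if_pos hj]
      · intro b _ hb
        rw [if_neg]
        intro h0
        exact hb (hi (Fin.ext (h0.trans hj.symm)))
      · simp
    · refine Finset.sum_eq_zero fun j _ => ?_
      split_ifs with h0
      · exact hinj t fun hi => h ⟨hi, j, h0⟩
      · rfl
  have h2 : ((M + 1).factorial : ℂ) * ∑ x : Weight (M + 1) k, g (L x) =
      ∑ p : Weight (M + 1) k × Perm (Fin (M + 1)), g (L p.1 ∘ p.2) := by
    rw [Fintype.sum_prod_type]
    simp only [hsymm, Finset.sum_const, Finset.card_univ, Fintype.card_perm, Fintype.card_fin,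
      nsmul_eq_mul, Finset.mul_sum]
  rw [h1, h2]
  refine Finset.sum_bij (fun p _ => L p.1 ∘ p.2) ?_ ?_ ?_ ?_
  · rintro ⟨x, π⟩ -
    simp only [Finset.mem_filter, Finset.mem_univ, true_and]
    refine ⟨(hLanti x).injective.comp π.injective, π.symm (Fin.last M), ?_⟩
    simp [hL, Weight.shifted_last]
  · rintro ⟨x, π⟩ - ⟨y, π'⟩ - h
    simp only at h
    have hr : Set.range (L x) = Set.range (L y) := by
      rw [← π.surjective.range_comp (L x), h, π'.surjective.range_comp]
    have hxy : L x = L y := by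
      have e : (L x) ∘ Fin.rev = (L y) ∘ Fin.rev := by
        have s : ∀ z, StrictMono (L z ∘ Fin.rev) := fun z i j hij =>
          hLanti z (Fin.rev_lt_rev.2 hij)
        refine (StrictMono.range_inj (s x) (s y)).1 ?_
        rw [Fin.rev_surjective.range_comp, Fin.rev_surjective.range_comp, hr]
      funext i
      simpa using congrFun e i.rev
    have hx : x = y := Weight.shifted_injective (funext fun i => congrArg Fin.val (congrFun hxy i))
    subst hx
    refine Prod.ext rfl (Equiv.ext fun i => (hLanti x).injective (congrFun h i))
  · intro t ht
    simp only [Finset.mem_filter, Finset.mem_univ, true_and] at ht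
    obtain ⟨hi, j, hj⟩ := ht
    -- Sorting and then reversing makes the tuple decreasing, so its value `0` comes last.
    set π : Perm (Fin (M + 1)) := Fin.revPerm.trans (Tuple.sort t) with hπ
    have hm : StrictAnti (t ∘ π) := by
      have hm0 : StrictMono (t ∘ Tuple.sort t) :=
        (Tuple.monotone_sort t).strictMono_of_injective (hi.comp (Tuple.sort t).injective)
      intro a b hab
      exact hm0 (Fin.rev_lt_rev.2 hab)
    obtain ⟨a, ha⟩ := Weight.exists_shifted_eq (k := k) (fun i => (t (π i) : ℕ))
      (fun a b h => hm h) (fun i => (t (π i)).2) (by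
        have : t (π (Fin.last M)) ≤ t (π (π.symm j)) := hm.antitone (Fin.le_last _)
        rw [Equiv.apply_symm_apply, Fin.le_def, hj] at this
        exact Nat.le_zero.1 this)
    refine ⟨(a, π.symm), Finset.mem_univ _, funext fun i => Fin.ext ?_⟩
    have := congrFun ha (π.symm i)
    simpa [hL] using this
  · intro p _
    rfl

end WZW

/-! ### Andréief's identity and determinantal sums through a point -/

namespace WZW

open Finset Equiv Matrix

section Andreief

variable {ι κ : Type*} [Fintype ι] [DecidableEq ι]

/-- Andréief's identity, with a separate weight for each variable. -/
theorem sum_prod_mul_det_mul_det [Fintype κ] (w : ι → κ → ℂ) (φ ψ : ι → κ → ℂ) :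
    ∑ t : ι → κ, (∏ j, w j (t j)) *
        ((of fun i j => φ i (t j)).det * (of fun i j => ψ i (t j)).det) =
      ∑ σ : Perm ι, ∑ τ : Perm ι, ((Perm.sign σ : ℤ) : ℂ) * ((Perm.sign τ : ℤ) : ℂ) *
        ∏ j, ∑ x, w j x * (φ (σ j) x * ψ (τ j) x) := by
  classical
  simp only [Finset.prod_univ_sum, Fintype.piFinset_univ, Finset.mul_sum]
  have h : ∀ t : ι → κ, (∏ j, w j (t j)) *
        ((of fun i j => φ i (t j)).det * (of fun i j => ψ i (t j)).det) =
      ∑ σ : Perm ι, ∑ τ : Perm ι, ((Perm.sign σ : ℤ) : ℂ) * ((Perm.sign τ : ℤ) : ℂ) *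
        ∏ j, w j (t j) * (φ (σ j) (t j) * ψ (τ j) (t j)) := by
    intro t
    rw [det_apply', det_apply', Finset.sum_mul_sum, Finset.mul_sum]
    refine Finset.sum_congr rfl fun σ _ => ?_
    rw [Finset.mul_sum]
    refine Finset.sum_congr rfl fun τ _ => ?_
    simp only [of_apply, Finset.prod_mul_distrib]
    ring
  rw [Finset.sum_congr rfl fun t _ => h t, Finset.sum_comm]
  exact Finset.sum_congr rfl fun σ _ => Finset.sum_comm

/-- With equal weights, replacing `σ` by `σ * τ` removes the dependence on `τ`, so every `τ`
contributes the same determinant. -/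
theorem sum_prod_mul_det_mul_det_const [Fintype κ] (w : κ → ℂ) (φ ψ : ι → κ → ℂ) :
    ∑ t : ι → κ, (∏ j, w (t j)) *
        ((of fun i j => φ i (t j)).det * (of fun i j => ψ i (t j)).det) =
      ((Fintype.card ι).factorial : ℂ) * (of fun i j => ∑ x, w x * (φ i x * ψ j x)).det := by
  rw [sum_prod_mul_det_mul_det (fun _ => w), Finset.sum_comm]
  have h : ∀ τ : Perm ι, ∑ σ : Perm ι, ((Perm.sign σ : ℤ) : ℂ) * ((Perm.sign τ : ℤ) : ℂ) *
      ∏ j, ∑ x, w x * (φ (σ j) x * ψ (τ j) x) =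
      (of fun i j => ∑ x, w x * (φ i x * ψ j x)).det := by
    intro τ
    rw [det_apply', ← Equiv.sum_comp (Equiv.mulRight τ)]
    refine Finset.sum_congr rfl fun σ _ => ?_
    simp only [Equiv.coe_mulRight, Perm.sign_mul, of_apply, Perm.mul_apply]
    rw [Units.val_mul, Int.cast_mul, mul_assoc (a := ((Perm.sign σ : ℤ) : ℂ)), ← Int.cast_mul,
      ← Units.val_mul, Int.units_mul_self]
    simp only [Units.val_one, Int.cast_one, mul_one]
    congr 1
    exact Equiv.prod_comp τ fun i => ∑ x, w x * (φ (σ i) x * ψ i x)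
  rw [Finset.sum_congr rfl fun τ _ => h τ, Finset.sum_const, Finset.card_univ,
    Fintype.card_perm, nsmul_eq_mul]

theorem det_apply_comp_perm (φ : ι → κ → ℂ) (t : ι → κ) (σ : Perm ι) :
    (of fun i j => φ i ((t ∘ σ) j)).det =
      ((Perm.sign σ : ℤ) : ℂ) * (of fun i j => φ i (t j)).det :=
  det_permute' σ (of fun i j => φ i (t j))

theorem det_mul_det_comp_perm (φ ψ : ι → κ → ℂ) (t : ι → κ) (σ : Perm ι) :
    (of fun i j => φ i ((t ∘ σ) j)).det * (of fun i j => ψ i ((t ∘ σ) j)).det =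
      (of fun i j => φ i (t j)).det * (of fun i j => ψ i (t j)).det := by
  rw [det_apply_comp_perm, det_apply_comp_perm]
  have : ((Perm.sign σ : ℤ) : ℂ) * ((Perm.sign σ : ℤ) : ℂ) = 1 := by
    rw [← Int.cast_mul, ← Units.val_mul, Int.units_mul_self]; simp
  linear_combination
    ((of fun i j => φ i (t j)).det * (of fun i j => ψ i (t j)).det) * this

theorem det_apply_eq_zero_of_not_injective (φ : ι → κ → ℂ) {t : ι → κ}
    (ht : ¬ Function.Injective t) : (of fun i j => φ i (t j)).det = 0 := by
  simp only [Function.Injective, not_forall] at ht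
  obtain ⟨a, b, hab, hne⟩ := ht
  exact det_zero_of_column_eq hne fun i => by simp [hab]

/-- If the Gram matrix `K i j = ∑ x, φ i x * ψ j x` has a rank one perturbation by the value at the
point `p` which is a rescaling of `K` of the same determinant, then the determinantal sum over
tuples through `p` vanishes. -/
theorem sum_det_mul_det_eq_zero [Fintype κ] [DecidableEq κ] (φ ψ : ι → κ → ℂ) (p : κ) {c : ℂ} (hc : c ≠ 0)
    (d e : ι → ℂ) (hd : ∏ i, d i = 1) (he : ∏ i, e i = 1)
    (h : ∀ i j, ∑ x, φ i x * ψ j x - c * (φ i p * ψ j p) = d i * (e j * ∑ x, φ i x * ψ j x)) :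
    ∑ t : ι → κ, ∑ j, (if t j = p then
      (of fun i j => φ i (t j)).det * (of fun i j => ψ i (t j)).det else 0) = 0 := by
  set g : (ι → κ) → ℂ := fun t =>
    (of fun i j => φ i (t j)).det * (of fun i j => ψ i (t j)).det with hg
  set K : Matrix ι ι ℂ := of fun i j => ∑ x, φ i x * ψ j x with hK
  -- Lowering the weight of `p` from `1` to `1 - c` is the rank one perturbation; by `h` the
  -- determinant does not change.
  have h1 := sum_prod_mul_det_mul_det_const (fun x => if x = p then 1 - c else 1) φ ψ
  have h2 := sum_prod_mul_det_mul_det_const (fun _ => 1) φ ψ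
  have e1 : (of fun i j => ∑ x, (if x = p then 1 - c else 1) * (φ i x * ψ j x)).det = K.det := by
    have : (of fun i j => ∑ x, (if x = p then 1 - c else 1) * (φ i x * ψ j x)) =
        of fun i j => d i * (of fun i j => e j * K i j) i j := by
      ext i j
      simp only [of_apply, hK]
      rw [← h i j]
      have : ∀ x, (if x = p then 1 - c else 1) * (φ i x * ψ j x) =
          φ i x * ψ j x - if x = p then c * (φ i x * ψ j x) else 0 := by
        intro x; split_ifs <;> ring
      simp only [this, Finset.sum_sub_distrib]
      simp
    rw [this, det_mul_column, det_mul_row, hd, he, one_mul, one_mul]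
  -- An injective tuple meets `p` at most once, so the product of weights is linear in `c`; other
  -- tuples have zero determinant.
  have e2 : ∀ t : ι → κ, (∏ j, if t j = p then 1 - c else 1) * g t =
      g t - c * ∑ j, if t j = p then g t else 0 := by
    intro t
    by_cases ht : Function.Injective t
    · by_cases hp : ∃ j, t j = p
      · obtain ⟨j, hj⟩ := hp
        have hb : ∀ b, b ≠ j → t b ≠ p := fun b hb h0 => hb (ht (h0.trans hj.symm))
        rw [Finset.prod_eq_single j (fun b _ hbj => if_neg (hb b hbj)) (by simp),
          Finset.sum_eq_single j (fun b _ hbj => if_neg (hb b hbj)) (by simp), if_pos hj, if_pos hj]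
        ring
      · push Not at hp
        simp [hp]
    · have : g t = 0 := by simp [hg, det_apply_eq_zero_of_not_injective φ ht]
      simp [this]
  rw [e1, Finset.sum_congr rfl fun t _ => e2 t, Finset.sum_sub_distrib, ← Finset.mul_sum] at h1
  simp only [Finset.prod_const_one, one_mul] at h2
  have h3 : c * ∑ t : ι → κ, ∑ j, (if t j = p then g t else 0) = 0 := by
    linear_combination h2 - h1
  exact (mul_eq_zero.1 h3).resolve_left hc

/-- The determinantal sum over tuples through `p` as a sum over pairs of permutations. -/
theorem sum_det_mul_det_eq_sum_perm [Fintype κ] [DecidableEq κ] (φ ψ : ι → κ → ℂ) (p : κ) :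
    ∑ t : ι → κ, ∑ j, (if t j = p then
      (of fun i j => φ i (t j)).det * (of fun i j => ψ i (t j)).det else 0) =
    ∑ l, ∑ σ : Perm ι, ∑ τ : Perm ι, ((Perm.sign σ : ℤ) : ℂ) * ((Perm.sign τ : ℤ) : ℂ) *
        ∏ j, if j = l then φ (σ j) p * ψ (τ j) p else ∑ x, φ (σ j) x * ψ (τ j) x := by
  rw [Finset.sum_comm]
  refine Finset.sum_congr rfl fun l _ => ?_
  -- The weight in slot `l` is the indicator of `p`; the other slots are free.
  have h := sum_prod_mul_det_mul_det (fun j x => if j = l then (if x = p then 1 else 0) else 1) φ ψ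
  calc _ = _ := Finset.sum_congr rfl fun t _ => by
        rw [Finset.prod_eq_single l (fun b _ hb => if_neg hb) (by simp), if_pos rfl, ite_mul,
          one_mul, zero_mul]
    _ = _ := h
    _ = _ := by
        refine Finset.sum_congr rfl fun σ _ => Finset.sum_congr rfl fun τ _ => ?_
        congr 1
        refine Finset.prod_congr rfl fun j _ => ?_
        split_ifs <;> simp

end Andreief

end WZW

/-! ### Exponentials and the Kac–Peterson determinant -/

namespace WZW

open Finset Equiv Matrix

/-- The exponential `exp (-2πi y / (k + N))`. -/
noncomputable def wave (N k : ℕ) (y : ℝ) : ℂ :=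
  Complex.exp (-(2 * (Real.pi : ℂ) * Complex.I / ((k : ℂ) + N)) * (y : ℂ))

section Wave

variable {N k : ℕ}

theorem wave_add (x y : ℝ) : wave N k (x + y) = wave N k x * wave N k y := by
  rw [wave, wave, wave, ← Complex.exp_add]; push_cast; ring_nf

theorem wave_zero : wave N k 0 = 1 := by simp [wave]

theorem wave_ne_zero (y : ℝ) : wave N k y ≠ 0 := Complex.exp_ne_zero _

theorem wave_sum {ι : Type*} (s : Finset ι) (f : ι → ℝ) :
    wave N k (∑ i ∈ s, f i) = ∏ i ∈ s, wave N k (f i) := by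
  simp only [wave, ← Complex.exp_sum, Complex.ofReal_sum, Finset.mul_sum]

theorem wave_mul_natCast (y : ℝ) (m : ℕ) : wave N k (y * m) = wave N k y ^ m := by
  rw [wave, wave, ← Complex.exp_nat_mul]; push_cast; ring_nf

theorem conj_wave (y : ℝ) : (starRingEnd ℂ) (wave N k y) = wave N k (-y) := by
  rw [wave, wave, ← Complex.exp_conj]
  have h2 : (starRingEnd ℂ) 2 = 2 := Complex.conj_ofNat 2
  simp only [map_mul, map_neg, map_div₀, map_add, h2, Complex.conj_ofReal, Complex.conj_I,
    map_natCast, Complex.ofReal_neg]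
  ring_nf

theorem wave_eq_one_iff (hN : 1 ≤ N) (y : ℝ) :
    wave N k y = 1 ↔ ∃ m : ℤ, y = m * ((k : ℝ) + N) := by
  have hn : ((k : ℝ) + N) ≠ 0 := by positivity
  have hn' : ((k : ℂ) + N) ≠ 0 := by exact_mod_cast hn
  have hpi : (2 * (Real.pi : ℂ) * Complex.I) ≠ 0 := Complex.two_pi_I_ne_zero
  rw [wave, Complex.exp_eq_one_iff]
  have key : ∀ m : ℤ, (-(2 * (Real.pi : ℂ) * Complex.I / ((k : ℂ) + N)) * (y : ℂ) =
      m * (2 * (Real.pi : ℂ) * Complex.I)) ↔ y = ((-m : ℤ) : ℝ) * ((k : ℝ) + N) := by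
    intro m
    rw [← Complex.ofReal_inj]
    push_cast
    have : -(2 * (Real.pi : ℂ) * Complex.I / ((k : ℂ) + N)) * (y : ℂ) =
        (-(y : ℂ) / ((k : ℂ) + N)) * (2 * (Real.pi : ℂ) * Complex.I) := by ring
    rw [this, mul_left_inj' hpi, div_eq_iff hn', neg_eq_iff_eq_neg]
    ring_nf
  constructor
  · rintro ⟨m, hm⟩
    exact ⟨-m, (key m).1 hm⟩
  · rintro ⟨m, hm⟩
    exact ⟨-m, (key (-m)).2 (by rw [neg_neg]; exact hm)⟩

end Wave

variable {M k : ℕ}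

/-- The prefactor of the Kac–Peterson formula. -/
noncomputable def prefactor (N k : ℕ) : ℂ :=
  Complex.I ^ (N * (N - 1) / 2) / ((Real.sqrt ((N : ℝ) * ((k : ℝ) + N) ^ (N - 1)) : ℝ) : ℂ)

theorem prefactor_mul_conj (N k : ℕ) :
    prefactor N k * (starRingEnd ℂ) (prefactor N k) = ((N : ℂ) * ((k : ℂ) + N) ^ (N - 1))⁻¹ := by
  rw [Complex.mul_conj, Complex.normSq_eq_norm_sq, prefactor, norm_div, norm_pow, Complex.norm_I,
    one_pow, Complex.norm_real, Real.norm_of_nonneg (Real.sqrt_nonneg _), div_pow,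
    Real.sq_sqrt (by positivity)]
  push_cast
  simp

theorem prefactor_ne_zero {N : ℕ} (hN : 1 ≤ N) (k : ℕ) : prefactor N k ≠ 0 := by
  intro h
  have := prefactor_mul_conj N k
  rw [h, zero_mul] at this
  have h1 : ((N : ℝ) * ((k : ℝ) + N) ^ (N - 1)) ≠ 0 := by positivity
  exact inv_ne_zero (by exact_mod_cast h1) this.symm

/-- The Kac–Peterson formula as a determinant. -/
theorem modularS_eq_det (b x : Weight (M + 1) k) :
    modularS b x = prefactor (M + 1) k *
      (of fun i j => wave (M + 1) k (b.regular i * x.shifted j)).det := by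
  rw [modularS, prefactor, det_apply']
  congr 1
  refine Finset.sum_congr rfl fun w _ => ?_
  congr 1
  have h : (b.toVector + weylVector (M + 1)) ⬝ᵥ weylAct w (x.toVector + weylVector (M + 1)) =
      ∑ j, b.regular (w j) * x.shifted j := by
    change ∑ i, b.regular i * x.regular (w.symm i) = _
    rw [← Equiv.sum_comp w]
    -- The constant `x.shift` drops out because the coordinates of `b + ρ` sum to zero.
    simp only [Equiv.symm_apply_apply, Weight.regular_apply x, mul_sub, Finset.sum_sub_distrib]
    rw [← Finset.sum_mul, Equiv.sum_comp w b.regular, b.sum_regular, zero_mul, sub_zero]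
  rw [h]
  exact wave_sum _ _

/-- The coordinates of `ρ` form an arithmetic progression, so the determinant is Vandermonde up to
column factors. Its nodes are distinct since the shifted labels of `x` are distinct integers in `[0,
k + N)`. -/
theorem modularS_vacuum_ne_zero (x : Weight (M + 1) k) :
    modularS (Weight.vacuum (M + 1) k) x ≠ 0 := by
  rw [modularS_eq_det]
  refine mul_ne_zero (prefactor_ne_zero (by omega) k) ?_
  set v := Weight.vacuum (M + 1) k
  have hshift : ∀ i : Fin (M + 1), (v.shifted i : ℝ) = M - (i : ℕ) := by
    intro i
    induction i using Fin.reverseInduction with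
    | last => simp [Weight.shifted_last]
    | cast i ih =>
      have h0 : v.1 i = 0 := rfl
      rw [Weight.shifted_castSucc, h0]
      push_cast
      rw [ih, Fin.val_succ, Fin.val_castSucc]
      push_cast
      ring
  have h : (of fun i j => wave (M + 1) k (v.regular i * x.shifted j)) =
      of fun i j => wave (M + 1) k ((M - v.shift) * x.shifted j) *
        (vandermonde fun j => wave (M + 1) k (-(x.shifted j : ℝ)))ᵀ i j := by
    ext i j
    rw [of_apply, of_apply, transpose_apply, vandermonde_apply, ← wave_mul_natCast, ← wave_add,
      v.regular_apply, hshift]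
    congr 1
    ring
  rw [h, det_mul_row, det_transpose]
  refine mul_ne_zero (Finset.prod_ne_zero_iff.2 fun _ _ => wave_ne_zero _)
    (det_vandermonde_ne_zero_iff.2 ?_)
  intro i j hij
  have h1 : wave (M + 1) k ((x.shifted i : ℝ) - x.shifted j) = 1 := by
    have hij' : wave (M + 1) k (-(x.shifted i : ℝ)) = wave (M + 1) k (-(x.shifted j : ℝ)) := hij
    rw [sub_eq_add_neg, wave_add, ← hij', ← wave_add, add_neg_cancel, wave_zero]
  obtain ⟨m, hm⟩ := (wave_eq_one_iff (by omega) _).1 h1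
  have hm' : (x.shifted i : ℤ) - x.shifted j = m * ((k + (M + 1) : ℕ) : ℤ) := by
    exact_mod_cast hm
  have hi := x.shifted_lt i
  have hj := x.shifted_lt j
  have h0 := Int.eq_zero_of_abs_lt_dvd (Dvd.intro_left m hm'.symm) (by rw [abs_lt]; omega)
  exact x.shifted_strictAnti.injective (by omega)

/-! ### Unitarity of the `S`-matrix -/

/-- The regular weights of the alcove form a fundamental domain: two of them which agree up to a
permutation, modulo `k + N`, are equal and the permutation is trivial. -/
theorem Weight.eq_of_regular_congr (b c : Weight (M + 1) k) (π : Perm (Fin (M + 1)))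
    (l : Fin (M + 1)) (h : ∀ i, i ≠ l → ∃ m : ℤ, b.regular i - c.regular (π i) =
      m * ((k : ℝ) + (M + 1 : ℕ))) : b = c ∧ π = 1 := by
  have hn : (0 : ℝ) < (k : ℝ) + (M + 1 : ℕ) := by positivity
  have h0 : ∑ i, (b.regular i - c.regular (π i)) = 0 := by
    rw [Finset.sum_sub_distrib, b.sum_regular, Equiv.sum_comp π c.regular, c.sum_regular, sub_zero]
  -- The congruence missing at `l` follows from the others, as all differences sum to zero.
  have hall : ∀ i, ∃ m : ℤ, b.regular i - c.regular (π i) = m * ((k : ℝ) + (M + 1 : ℕ)) := by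
    intro i
    by_cases hi : i = l
    · subst hi
      choose! m hm using h
      rw [← Finset.add_sum_erase _ _ (Finset.mem_univ i)] at h0
      rw [Finset.sum_congr rfl fun j hj => hm j (Finset.ne_of_mem_erase hj)] at h0
      refine ⟨-∑ j ∈ Finset.univ.erase i, m j, ?_⟩
      rw [← Finset.sum_mul] at h0
      push_cast at h0 ⊢
      linarith
    · exact h i hi
  choose m hm using hall
  have hsum : ∑ i, m i = 0 := by
    simp only [hm, ← Finset.sum_mul] at h0
    have := (mul_eq_zero.1 h0).resolve_right hn.ne'
    exact_mod_cast this
  -- The coordinates of each regular weight spread over less than `k + N`.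
  have hle : ∀ i j, m i - m j < 2 := by
    intro i j
    by_contra hcon
    push Not at hcon
    have h1 := b.regular_sub_lt i j
    have h2 := c.regular_sub_lt (π j) (π i)
    have h3 := hm i
    have h4 := hm j
    have h5 : (2 : ℝ) ≤ (m i : ℝ) - m j := by exact_mod_cast hcon
    have h6 : 2 * ((k : ℝ) + (M + 1 : ℕ)) ≤ ((m i : ℝ) - m j) * ((k : ℝ) + (M + 1 : ℕ)) :=
      mul_le_mul_of_nonneg_right h5 hn.le
    push_cast at *
    linarith
  -- Integers with zero sum, not all zero, include a positive and a negative one, which differ by at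
  -- least `2`.
  have hzero : ∀ i, m i = 0 := by
    by_contra hcon
    push Not at hcon
    obtain ⟨i, -, hi⟩ := Finset.exists_pos_of_sum_zero_of_exists_nonzero m hsum
      (by obtain ⟨i, hi⟩ := hcon; exact ⟨i, Finset.mem_univ i, hi⟩)
    obtain ⟨j, -, hj⟩ := Finset.exists_pos_of_sum_zero_of_exists_nonzero (fun i => -m i)
      (by rw [Finset.sum_neg_distrib, hsum, neg_zero])
      (by obtain ⟨i, hi⟩ := hcon; exact ⟨i, Finset.mem_univ i, neg_ne_zero.2 hi⟩)
    have := hle i j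
    omega
  have heq : ∀ i, b.regular i = c.regular (π i) := by
    intro i
    have := hm i
    rw [hzero i] at this
    simpa [sub_eq_zero] using this
  have hmono : StrictMono π := by
    intro i j hij
    have h1 := b.regular_strictAnti hij
    rw [heq i, heq j] at h1
    exact c.regular_strictAnti.lt_iff_gt.1 h1
  have hπ : π = 1 := by
    have : ((StrictMono.orderIsoOfSurjective π hmono π.surjective) : Fin (M + 1) ≃o Fin (M + 1)) =
      OrderIso.refl _ := Subsingleton.elim _ _
    ext i
    exact congrArg Fin.val (congrArg (fun f : Fin (M + 1) ≃o Fin (M + 1) => f i) this)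
  refine ⟨Weight.regular_injective (funext fun i => ?_), hπ⟩
  rw [heq i, hπ, Perm.one_apply]

/-- The Gram matrix of the exponentials of two weights is a geometric sum. -/
theorem sum_wave_mul_conj_wave (n : ℕ) (y z : ℝ) :
    ∑ t : Fin n, wave (M + 1) k (y * (t : ℕ)) * (starRingEnd ℂ) (wave (M + 1) k (z * (t : ℕ))) =
      ∑ t ∈ Finset.range n, wave (M + 1) k (y - z) ^ t := by
  rw [Finset.sum_range]
  refine Finset.sum_congr rfl fun t _ => ?_
  rw [conj_wave, ← wave_add, ← wave_mul_natCast]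
  congr 1
  ring

/-- The shifted labels are integers and contribute full periods, so only the difference of the
shifts survives, whatever `i` and `j`. -/
theorem wave_regular_sub_pow (b c : Weight (M + 1) k) (i j : Fin (M + 1)) :
    wave (M + 1) k (b.regular i - c.regular j) ^ (k + (M + 1)) =
      wave (M + 1) k ((c.shift - b.shift) * (k + (M + 1) : ℕ)) := by
  have h1 : wave (M + 1) k ((((b.shifted i : ℤ) - c.shifted j : ℤ) : ℝ) *
      ((k : ℝ) + (M + 1 : ℕ))) = 1 := (wave_eq_one_iff (by omega) _).2 ⟨_, rfl⟩
  rw [← wave_mul_natCast, ← one_mul (wave _ _ ((c.shift - b.shift) * _)), ← h1, ← wave_add]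
  congr 1
  rw [b.regular_apply, c.regular_apply]
  push_cast
  ring

theorem sum_tuples_eq (b c : Weight (M + 1) k) :
    ∑ t : Fin (M + 1) → Fin (k + (M + 1)), ∑ j, (if t j = 0 then
      (of fun i j => wave (M + 1) k (b.regular i * (t j : ℕ))).det *
      (of fun i j => (starRingEnd ℂ) (wave (M + 1) k (c.regular i * (t j : ℕ)))).det else 0) =
    if b = c then ((M + 1).factorial : ℂ) * ((M + 1 : ℕ) * ((k : ℂ) + (M + 1 : ℕ)) ^ M) else 0 := by
  set φ : Fin (M + 1) → Fin (k + (M + 1)) → ℂ :=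
    fun i t => wave (M + 1) k (b.regular i * (t : ℕ)) with hφ
  set ψ : Fin (M + 1) → Fin (k + (M + 1)) → ℂ :=
    fun i t => (starRingEnd ℂ) (wave (M + 1) k (c.regular i * (t : ℕ))) with hψ
  have hK : ∀ i j, ∑ t, φ i t * ψ j t = ∑ t ∈ Finset.range (k + (M + 1)),
      wave (M + 1) k (b.regular i - c.regular j) ^ t := fun i j => sum_wave_mul_conj_wave _ _ _
  have h0 : ∀ i j, φ i 0 * ψ j 0 = 1 := by
    intro i j; simp [hφ, hψ, wave_zero]
  have hgeom : ∀ i j, (∑ t, φ i t * ψ j t) *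
      (1 - wave (M + 1) k (b.regular i - c.regular j)) =
      1 - wave (M + 1) k ((c.shift - b.shift) * (k + (M + 1) : ℕ)) := by
    intro i j
    rw [hK, geom_sum_mul_neg, wave_regular_sub_pow]
  by_cases hc : 1 - wave (M + 1) k ((c.shift - b.shift) * (k + (M + 1) : ℕ)) = 0
  · change ∑ t : Fin (M + 1) → Fin (k + (M + 1)), ∑ j, (if t j = 0 then
      (of fun i j => φ i (t j)).det * (of fun i j => ψ i (t j)).det else 0) = _
    rw [sum_det_mul_det_eq_sum_perm]
    simp only [h0]
    have hterm : ∀ (l) (σ τ : Perm (Fin (M + 1))),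
        ((Perm.sign σ : ℤ) : ℂ) * ((Perm.sign τ : ℤ) : ℂ) *
          (∏ j, if j = l then 1 else ∑ x, φ (σ j) x * ψ (τ j) x) =
        if σ = τ then (if b = c then ((k : ℂ) + (M + 1 : ℕ)) ^ M else 0) else 0 := by
      intro l σ τ
      by_cases hst : b = c ∧ σ = τ
      · obtain ⟨rfl, rfl⟩ := hst
        rw [if_pos rfl, if_pos rfl, ← Int.cast_mul, ← Units.val_mul, Int.units_mul_self,
          ← Finset.mul_prod_erase _ _ (Finset.mem_univ l), if_pos rfl,
          Finset.prod_congr rfl fun j hj => if_neg (Finset.ne_of_mem_erase hj)]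
        simp only [hK, sub_self, wave_zero]
        simp
      -- A nonzero geometric sum has ratio `1`, hence a congruence modulo `k + N`. Slot `l` gives
      -- none, which is why one index is exempt in `eq_of_regular_congr`.
      · have hz : ∏ j, (if j = l then 1 else ∑ x, φ (σ j) x * ψ (τ j) x) = 0 := by
          by_contra hne
          rw [← ne_eq, Finset.prod_ne_zero_iff] at hne
          apply hst
          have := b.eq_of_regular_congr c (τ * σ⁻¹) (σ l) fun i hi => by
            have h1 := hne (σ⁻¹ i) (Finset.mem_univ _)
            rw [if_neg (fun e => hi (by rw [← e]; simp))] at h1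
            have h2 := hgeom (σ (σ⁻¹ i)) (τ (σ⁻¹ i))
            rw [hc] at h2
            have h3 := (mul_eq_zero.1 h2).resolve_left h1
            have h4 := (wave_eq_one_iff (by omega) _).1 (sub_eq_zero.1 h3).symm
            simpa using h4
          exact ⟨this.1, (mul_inv_eq_one.1 this.2).symm⟩
        rw [hz, mul_zero]
        split_ifs with h1 h2
        · exact absurd ⟨h2, h1⟩ hst
        · rfl
        · rfl
    simp only [hterm]
    -- The slot `l` contributes the factor `M + 1`, the diagonal `σ = τ` the factorial.
    simp only [Finset.sum_ite_eq, Finset.mem_univ, if_true, Finset.sum_const, Finset.card_univ,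
      Fintype.card_perm, Fintype.card_fin, nsmul_eq_mul]
    split_ifs
    · ring
    · simp
  · have hbc : b ≠ c := by
      rintro rfl
      simp [wave_zero] at hc
    rw [if_neg hbc]
    -- With `c = 1 - ω`, the geometric sum formula `K (1 - q) = 1 - ω` reads `K - c = q K`. Since
    -- `q` splits into a row and a column factor, this is a rescaling, of determinant one by the
    -- zero coordinate sums.
    refine sum_det_mul_det_eq_zero φ ψ 0 hc (fun i => wave (M + 1) k (b.regular i))
      (fun j => wave (M + 1) k (-c.regular j)) ?_ ?_ ?_
    · rw [← wave_sum, b.sum_regular, wave_zero]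
    · rw [← wave_sum, Finset.sum_neg_distrib, c.sum_regular, neg_zero, wave_zero]
    · intro i j
      rw [h0, mul_one, ← mul_assoc, ← wave_add, ← sub_eq_add_neg]
      linear_combination hgeom i j

/-- The modular `S`-matrix is unitary. -/
theorem sum_modularS_mul_conj_modularS (b c : Weight (M + 1) k) :
    ∑ x, modularS b x * (starRingEnd ℂ) (modularS c x) = if b = c then 1 else 0 := by
  set g : (Fin (M + 1) → Fin (k + (M + 1))) → ℂ := fun t =>
    (of fun i j => wave (M + 1) k (b.regular i * (t j : ℕ))).det *
      (of fun i j => (starRingEnd ℂ) (wave (M + 1) k (c.regular i * (t j : ℕ)))).det with hg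
  have h := factorial_mul_sum_weight g
    (det_mul_det_comp_perm (fun i (t : Fin (k + (M + 1))) => wave (M + 1) k (b.regular i * (t : ℕ)))
      fun i (t : Fin (k + (M + 1))) => (starRingEnd ℂ) (wave (M + 1) k (c.regular i * (t : ℕ))))
    fun t ht => by
      have := det_apply_eq_zero_of_not_injective
        (fun i (t : Fin (k + (M + 1))) => wave (M + 1) k (b.regular i * (t : ℕ))) ht
      simp only [hg, this, zero_mul]
  have h1 : ∀ x : Weight (M + 1) k, modularS b x * (starRingEnd ℂ) (modularS c x) =
      (prefactor (M + 1) k * (starRingEnd ℂ) (prefactor (M + 1) k)) *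
        g (fun i => ⟨x.shifted i, x.shifted_lt i⟩) := by
    intro x
    rw [modularS_eq_det, modularS_eq_det, map_mul, RingHom.map_det]
    simp only [hg]
    have : (starRingEnd ℂ).mapMatrix (of fun i j => wave (M + 1) k (c.regular i * x.shifted j)) =
        of fun i j => (starRingEnd ℂ) (wave (M + 1) k (c.regular i * x.shifted j)) := rfl
    rw [this]
    ring
  have h2 := sum_tuples_eq b c
  simp only [Fin.ext_iff, Fin.val_zero] at h2
  rw [h2] at h
  rw [Finset.sum_congr rfl fun x _ => h1 x, ← Finset.mul_sum, prefactor_mul_conj]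
  have hf : ((M + 1).factorial : ℂ) ≠ 0 := by exact_mod_cast (M + 1).factorial_ne_zero
  have hn : (((M + 1 : ℕ) : ℂ) * ((k : ℂ) + (M + 1 : ℕ)) ^ M) ≠ 0 := by
    have : (((M + 1 : ℕ) : ℝ) * ((k : ℝ) + (M + 1 : ℕ)) ^ M) ≠ 0 := by positivity
    exact_mod_cast this
  have hs : ∑ x : Weight (M + 1) k, g (fun i => ⟨x.shifted i, x.shifted_lt i⟩) =
      if b = c then ((M + 1 : ℕ) : ℂ) * ((k : ℂ) + (M + 1 : ℕ)) ^ M else 0 := by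
    apply mul_left_cancel₀ hf
    rw [h]
    split_ifs <;> simp
  rw [hs, Nat.add_sub_cancel]
  split_ifs
  · exact inv_mul_cancel₀ hn
  · exact mul_zero _

/-! ### The vacuum as unit of the fusion product -/

theorem fusionCoeff_comm {N k : ℕ} (a b c : Weight N k) :
    fusionCoeff a b c = fusionCoeff b a c :=
  Finset.sum_congr rfl fun x _ => by rw [mul_comm (modularS a x)]

theorem fusionCoeff_vacuum (b c : Weight (M + 1) k) :
    fusionCoeff (Weight.vacuum (M + 1) k) b c = if b = c then 1 else 0 := by
  rw [← sum_modularS_mul_conj_modularS, fusionCoeff]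
  refine Finset.sum_congr rfl fun x _ => ?_
  rw [mul_assoc, mul_div_cancel_left₀ _ (modularS_vacuum_ne_zero x)]

theorem FusionAlgebra.mul_comm {N k : ℕ} (x y : FusionAlgebra N k) : x * y = y * x := by
  funext c
  rw [mul_apply, mul_apply, Finset.sum_comm]
  refine Finset.sum_congr rfl fun a _ => Finset.sum_congr rfl fun b _ => ?_
  rw [fusionCoeff_comm, _root_.mul_comm (x b)]

theorem FusionAlgebra.vacuum_mul (x : FusionAlgebra (M + 1) k) :
    primary (Weight.vacuum (M + 1) k) * x = x := by
  funext c
  rw [mul_apply, Finset.sum_eq_single (Weight.vacuum (M + 1) k)]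
  · simp only [primary, if_true, one_mul, fusionCoeff_vacuum, mul_ite, mul_one, mul_zero]
    exact (Finset.sum_ite_eq' Finset.univ c x).trans (if_pos (Finset.mem_univ c))
  · intro a _ ha
    simp [primary, ha]
  · simp

end WZW

theorem mainTheorem5 (N k : ℕ) (hN : 1 ≤ N) :
    (∀ b c : WZW.Weight N k,
      WZW.fusionCoeff (WZW.Weight.vacuum N k) b c = if b = c then 1 else 0) ∧
    (∀ a : WZW.Weight N k,
      WZW.cls (WZW.Weight.vacuum N k) * WZW.cls a = WZW.cls a ∧
      WZW.cls a * WZW.cls (WZW.Weight.vacuum N k) = WZW.cls a) ∧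
    (∀ x : WZW.fusionRing N k,
      WZW.cls (WZW.Weight.vacuum N k) * x = x ∧
      x * WZW.cls (WZW.Weight.vacuum N k) = x) := by
  obtain ⟨M, rfl⟩ : ∃ M, N = M + 1 := ⟨N - 1, by omega⟩
  have hunit : ∀ x : WZW.fusionRing (M + 1) k,
      WZW.cls (WZW.Weight.vacuum (M + 1) k) * x = x ∧
      x * WZW.cls (WZW.Weight.vacuum (M + 1) k) = x := fun x =>
    ⟨Subtype.ext (WZW.FusionAlgebra.vacuum_mul x.1),
      Subtype.ext ((WZW.FusionAlgebra.mul_comm _ _).trans (WZW.FusionAlgebra.vacuum_mul x.1))⟩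
  exact ⟨WZW.fusionCoeff_vacuum, fun a => hunit _, hunit⟩
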